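/- Let $P>1$ and $\eta>0$ be real numbers and let $k$ be a positive integer. Let $G$ be a finite simple graph with exactly $\ell = Pk$ vertices (so $Pk$ is an integer) and minimum degree $$\delta(G) \ge \tfrac12 \ell + \eta\sqrt{\ell}.$$ Then $G$ has an induced subgraph $H$ on exactly $k$ vertices with minimum degree $$\delta(H) \ge \tfrac12 k + \left(\frac{\eta}{\sqrt P} - 19\sqrt P\right)\sqrt k.$$ -/

import Mathlib

/-! Weight `1 / P` on every vertex has total `k` and gives each vertex fractional degree `deg / P`,
which is the desired main term. It remains to round this point to a `k`-set while every degree drops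
by only O(√ℓ), as in Spencer's discrepancy theorem. `exists_partial_rounding` halves the number of
fractional coordinates by maximizing a quadratic reward minus an exponential penalty on row losses:
with too many fractional coordinates left, a trace count contradicts the second-order condition. The
losses of successive halvings form a convergent series, and the last 16 coordinates are rounded
arbitrarily. -/

/-! ### Trace bound and auxiliary estimates. -/

/-- Sum the hypothesis over an orthonormal basis of the space of admissible `u`: the left side gives
twice the dimension, and Bessel bounds each row's share by its squared norm on `B`. -/
theorem finrank_le_of_quadratic_bound {V ι : Type*} [Fintype V] [DecidableEq V] [Fintype ι]
    (a : ι → V → ℝ) (ha : ∀ j i, |a j i| ≤ 1) (c : ι → ℝ) (hc : ∀ j, 0 ≤ c j)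
    (B : Finset V) (J : Finset ι)
    (h : ∀ u : V → ℝ, (∀ i ∉ B, u i = 0) → ∑ i, u i = 0 → (∀ j ∈ J, ∑ i, a j i * u i = 0) →
      2 * ∑ i, u i ^ 2 ≤ ∑ j, c j * (∑ i, a j i * u i) ^ 2) :
    2 * ((B.card : ℝ) - 1 - J.card) ≤ B.card * ∑ j, c j := by
  classical
  let L : EuclideanSpace ℝ V →ₗ[ℝ] ({i // i ∉ B} → ℝ) × ℝ × (J → ℝ) :=
    { toFun := fun u => (fun i => u i, ∑ i, u i, fun j => ∑ i, a j i * u i)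
      map_add' := by
        intro u v
        simp [mul_add, Finset.sum_add_distrib, funext_iff]
      map_smul' := by
        intro r u
        simp [Finset.mul_sum, funext_iff, mul_left_comm] }
  let U := LinearMap.ker L
  have hU : ∀ u ∈ U, (∀ i ∉ B, u i = 0) ∧ ∑ i, u i = 0 ∧ ∀ j ∈ J, ∑ i, a j i * u i = 0 := by
    intro u hu
    have hL : L u = 0 := hu
    simp only [L, LinearMap.coe_mk, AddHom.coe_mk, Prod.mk_eq_zero, funext_iff] at hL
    exact ⟨fun i hi => hL.1 ⟨i, hi⟩, hL.2.1, fun j hj => hL.2.2 ⟨j, hj⟩⟩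
  have hdim : (B.card : ℝ) - 1 - J.card ≤ Module.finrank ℝ U := by
    have h1 := L.finrank_range_add_finrank_ker
    have h2 := (LinearMap.range L).finrank_le
    simp only [Module.finrank_prod, Module.finrank_fintype_fun_eq_card, Module.finrank_self,
      finrank_euclideanSpace, Fintype.card_coe, Fintype.card_subtype_compl] at h1 h2
    have h3 : B.card ≤ Fintype.card V := Finset.card_le_univ B
    have h4 : B.card ≤ Module.finrank ℝ U + 1 + J.card := by
      simp only [U]
      omega
    have h5 : (B.card : ℝ) ≤ Module.finrank ℝ U + 1 + J.card := by exact_mod_cast h4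
    linarith
  let b : ι → EuclideanSpace ℝ V := fun j => WithLp.toLp 2 fun i => if i ∈ B then a j i else 0
  have hb : ∀ j, ‖b j‖ ^ 2 ≤ B.card := by
    intro j
    rw [EuclideanSpace.norm_sq_eq, Finset.card_eq_sum_ones, ← Finset.sum_filter_add_sum_filter_not
      Finset.univ (· ∈ B)]
    have h0 : ∑ x ∈ Finset.univ with x ∉ B, ‖(b j) x‖ ^ 2 = 0 :=
      Finset.sum_eq_zero fun x hx => by simp [b, (Finset.mem_filter.1 hx).2]
    rw [h0, add_zero]
    push_cast
    have h1 : Finset.univ.filter (· ∈ B) = B := by ext; simp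
    rw [h1]
    refine Finset.sum_le_sum fun i hi => ?_
    simp only [b, hi, if_true, Real.norm_eq_abs, sq_abs]
    rw [← sq_abs]
    exact pow_le_one₀ (abs_nonneg _) (ha j i)
  let e := stdOrthonormalBasis ℝ U
  have he : Orthonormal ℝ fun k => (e k : EuclideanSpace ℝ V) :=
    e.orthonormal.comp_linearIsometry U.subtypeₗᵢ
  have hin : ∀ j k, inner ℝ (e k : EuclideanSpace ℝ V) (b j)
      = ∑ i, a j i * (e k : EuclideanSpace ℝ V) i := by
    intro j k
    rw [PiLp.inner_apply]
    refine Finset.sum_congr rfl fun i _ => ?_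
    by_cases hi : i ∈ B
    · simp [b, hi]
    · simp [b, hi, (hU _ (e k).2).1 i hi]
  have hk : ∀ k, (2 : ℝ) ≤ ∑ j, c j * ‖inner ℝ (e k : EuclideanSpace ℝ V) (b j)‖ ^ 2 := by
    intro k
    obtain ⟨h1, h2, h3⟩ := hU _ (e k).2
    have h4 := h _ h1 h2 h3
    have h5 : ∑ i, (e k : EuclideanSpace ℝ V) i ^ 2 = 1 := by
      have := he.1 k
      have h6 := EuclideanSpace.norm_sq_eq (e k : EuclideanSpace ℝ V)
      rw [this] at h6
      simpa using h6.symm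
    rw [h5, mul_one] at h4
    simpa only [hin, Real.norm_eq_abs, sq_abs] using h4
  calc 2 * ((B.card : ℝ) - 1 - J.card) ≤ 2 * Module.finrank ℝ U := by linarith
    _ = ∑ _k : Fin (Module.finrank ℝ U), (2 : ℝ) := by simp [mul_comm]
    _ ≤ ∑ k, ∑ j, c j * ‖inner ℝ (e k : EuclideanSpace ℝ V) (b j)‖ ^ 2 :=
        Finset.sum_le_sum fun k _ => hk k
    _ = ∑ j, c j * ∑ k, ‖inner ℝ (e k : EuclideanSpace ℝ V) (b j)‖ ^ 2 := by
        rw [Finset.sum_comm]; simp only [Finset.mul_sum]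
    _ ≤ ∑ j, c j * B.card := Finset.sum_le_sum fun j _ =>
        mul_le_mul_of_nonneg_left ((he.sum_inner_products_le (b j)).trans (hb j)) (hc j)
    _ = B.card * ∑ j, c j := by rw [← Finset.sum_mul, mul_comm]

/-- The second-order coefficient is 1; the slack up to 5/4 absorbs the higher-order terms. -/
theorem eventually_two_mul_cosh_sub_one_le (z : ℝ) :
    ∀ᶠ t : ℝ in nhds 0, Real.exp (t * z) + Real.exp (-(t * z)) - 2 ≤ 5 / 4 * (t * z) ^ 2 := by
  have h : Filter.Tendsto (fun t : ℝ => (t * z) ^ 2 / 2) (nhds 0) (nhds 0) := by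
    have : Continuous fun t : ℝ => (t * z) ^ 2 / 2 := by fun_prop
    simpa using this.tendsto 0
  filter_upwards [h.eventually_le_const (show (0 : ℝ) < 1 / 4 by norm_num)] with t ht
  have h1 := Real.cosh_le_exp_half_sq (t * z)
  have h0 : 0 ≤ (t * z) ^ 2 / 2 := by positivity
  have h2 := Real.abs_exp_sub_one_sub_id_le (x := (t * z) ^ 2 / 2)
    (by rw [abs_of_nonneg h0]; linarith)
  have h3 := (abs_le.1 h2).2
  rw [Real.cosh_eq] at h1
  nlinarith

/-- If rounding a few coordinates of a fractional point keeps the coordinate sum, the rounded point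
can be taken to be the indicator of a set of the prescribed size. -/
theorem exists_finset_card_eq_of_sum_eq {V ι : Type*} [Fintype V] [DecidableEq V]
    (a : ι → V → ℝ) (ha0 : ∀ j i, 0 ≤ a j i) (ha1 : ∀ j i, a j i ≤ 1)
    (y : V → ℝ) (hy : ∀ i, y i ∈ Set.Icc (0 : ℝ) 1) (k : ℕ) (hk : ∑ i, y i = k) :
    ∃ Z : Finset V, Z.card = k ∧ ∀ j, ∑ i, a j i * y i
      - (Finset.univ.filter fun i => 0 < y i ∧ y i < 1).card ≤ ∑ i ∈ Z, a j i := by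
  classical
  set B := Finset.univ.filter fun i => 0 < y i ∧ y i < 1 with hB
  set O := Finset.univ.filter fun i => y i = 1 with hO
  have hd : Disjoint O B := by
    rw [Finset.disjoint_left]
    intro i hi hi'
    simp only [hO, hB, Finset.mem_filter, Finset.mem_univ, true_and] at hi hi'
    linarith
  have h1 : (O.card : ℝ) ≤ k := by
    rw [← hk, Finset.card_eq_sum_ones]
    push_cast
    calc ∑ i ∈ O, (1 : ℝ) = ∑ i ∈ O, y i := Finset.sum_congr rfl fun i hi => by
          simp [(Finset.mem_filter.1 hi).2]
      _ ≤ ∑ i, y i := Finset.sum_le_univ_sum_of_nonneg fun i => (hy i).1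
  have hz : ∀ i ∉ O ∪ B, y i = 0 := by
    intro i hi
    simp only [hO, hB, Finset.mem_union, Finset.mem_filter, Finset.mem_univ, true_and] at hi
    push Not at hi
    by_contra h0
    exact hi.1 (le_antisymm (hy i).2 (hi.2 (lt_of_le_of_ne (hy i).1 (Ne.symm h0))))
  have h2 : (k : ℝ) ≤ (O ∪ B).card := by
    rw [← hk, ← Finset.sum_subset (Finset.subset_univ (O ∪ B)) fun i _ hi => hz i hi]
    calc ∑ i ∈ O ∪ B, y i ≤ ∑ i ∈ O ∪ B, 1 := Finset.sum_le_sum fun i _ => (hy i).2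
      _ = (O ∪ B).card := by simp
  obtain ⟨Z, hOZ, hZ, hZk⟩ := Finset.exists_subsuperset_card_eq (Finset.subset_union_left)
    (by exact_mod_cast h1 : O.card ≤ k) (by exact_mod_cast h2)
  refine ⟨Z, hZk, fun j => ?_⟩
  have h3 : ∑ i, (a j i * y i - if i ∈ Z then a j i else 0) ≤ ∑ i, if i ∈ B then (1 : ℝ) else 0 := by
    refine Finset.sum_le_sum fun i _ => ?_
    have := hy i
    have h4 := ha0 j i
    have h5 := ha1 j i
    by_cases hiB : i ∈ B
    · have : a j i * y i ≤ 1 := mul_le_one₀ h5 this.1 this.2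
      simp only [hiB, if_true]
      split_ifs <;> linarith
    · by_cases hiO : i ∈ O
      · have h6 : y i = 1 := (Finset.mem_filter.1 hiO).2
        simp [hOZ hiO, hiB, h6]
      · have : y i = 0 := hz i (by simp [hiO, hiB])
        simp only [this, hiB, if_false]
        split_ifs <;> linarith
  rw [Finset.sum_sub_distrib] at h3
  simp only [Finset.sum_ite_mem, Finset.univ_inter, Finset.sum_const, nsmul_eq_mul, mul_one] at h3
  linarith

/-! ### One halving step. -/

theorem exists_partial_rounding {V ι : Type*} [Fintype V] [DecidableEq V] [Fintype ι]
    (a : ι → V → ℝ) (ha : ∀ j i, |a j i| ≤ 1)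
    (x : V → ℝ) (hx : ∀ i, x i ∈ Set.Icc (0 : ℝ) 1) (m : ℝ) (hm : 16 ≤ m)
    (hmn : m ≤ Fintype.card ι)
    (hxm : ((Finset.univ.filter fun i => 0 < x i ∧ x i < 1).card : ℝ) ≤ m) :
    ∃ y : V → ℝ, (∀ i, y i ∈ Set.Icc (0 : ℝ) 1) ∧ ∑ i, y i = ∑ i, x i ∧
      ((Finset.univ.filter fun i => 0 < y i ∧ y i < 1).card : ℝ) ≤ m / 2 ∧
      ∀ j, ∑ i, a j i * (x i - y i) ≤ 2 * √m / 3 * Real.log (32 * Fintype.card ι / m) := by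
  classical
  set A := Finset.univ.filter fun i => 0 < x i ∧ x i < 1 with hA
  set n : ℝ := (Fintype.card ι : ℝ) with hn
  set Δ := 2 * √m / 3 * Real.log (32 * n / m) with hΔ
  set w := m / (4 * n) with hw
  set l := 3 / (2 * √m) with hl
  have hm0 : 0 < m := by linarith
  have hn0 : 0 < n := by linarith
  have hw0 : 0 < w := by positivity
  have hsm : 0 < √m := Real.sqrt_pos.2 hm0
  have hl2 : l ^ 2 = 9 / (4 * m) := by
    rw [hl, div_pow, mul_pow, Real.sq_sqrt hm0.le]; norm_num
  have hlΔ : Real.exp (l * Δ) = 32 * n / m := by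
    have : l * Δ = Real.log (32 * n / m) := by
      rw [hl, hΔ]; field_simp
    rw [this, Real.exp_log (by positivity)]
  have hΔ0 : 0 ≤ Δ := by
    refine mul_nonneg (by positivity) (Real.log_nonneg ?_)
    rw [le_div_iff₀ hm0]; linarith
  let s : ι → (V → ℝ) → ℝ := fun j y => ∑ i, a j i * (x i - y i)
  have hsc : ∀ j, Continuous (s j) := fun j => by fun_prop
  let D : Set (V → ℝ) := {y | (∀ i, y i ∈ Set.Icc (0 : ℝ) 1) ∧ (∀ i ∉ A, y i = x i) ∧
    ∑ i, y i = ∑ i, x i ∧ ∀ j, s j y ≤ Δ}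
  have hDc : IsCompact D := by
    refine (isCompact_univ_pi fun _ : V => isCompact_Icc (a := (0 : ℝ)) (b := 1)).of_isClosed_subset
      ?_ fun y hy i _ => hy.1 i
    simp only [D, Set.ofPred_and, Set.ofPred_forall]
    refine IsClosed.inter ?_ (IsClosed.inter ?_ (IsClosed.inter ?_ ?_))
    · exact isClosed_iInter fun i => isClosed_Icc.preimage (continuous_apply i)
    · exact isClosed_iInter fun i => isClosed_iInter fun _ =>
        isClosed_eq (continuous_apply i) continuous_const
    · exact isClosed_eq (by fun_prop) continuous_const
    · exact isClosed_iInter fun j => isClosed_le (hsc j) continuous_const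
  have hxD : x ∈ D := ⟨hx, fun _ _ => rfl, rfl, fun j => by simpa [s] using hΔ0⟩
  -- The square term pushes coordinates towards 0 and 1. The weight `w` makes the penalty at `x`
  -- equal to `m / 4`; since the square term is at most `m / 4`, the penalty at a maximizer is at
  -- most `m / 2`.
  let F : (V → ℝ) → ℝ := fun y => ∑ i ∈ A, (y i - 1 / 2) ^ 2 - w * ∑ j, Real.exp (l * s j y)
  have hF : Continuous F := by fun_prop
  obtain ⟨y, hyD, hy⟩ := hDc.exists_isMaxOn ⟨x, hxD⟩ hF.continuousOn
  obtain ⟨hy01, hyA, hysum, hyΔ⟩ := id hyD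
  refine ⟨y, hy01, hysum, ?_, hyΔ⟩
  have hpot : w * ∑ j, Real.exp (l * s j y) ≤ m / 2 := by
    have h1 : F x ≤ F y := hy hxD
    have h2 : ∑ i ∈ A, (y i - 1 / 2) ^ 2 ≤ m / 4 := by
      calc ∑ i ∈ A, (y i - 1 / 2) ^ 2 ≤ ∑ i ∈ A, (1 / 4 : ℝ) :=
            Finset.sum_le_sum fun i _ => by nlinarith [(hy01 i).1, (hy01 i).2]
        _ ≤ m / 4 := by rw [Finset.sum_const, nsmul_eq_mul]; linarith
    have h3 : 0 ≤ ∑ i ∈ A, (x i - 1 / 2) ^ 2 := Finset.sum_nonneg fun _ _ => sq_nonneg _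
    have h4 : w * ∑ j, Real.exp (l * s j x) = m / 4 := by
      simp only [s, sub_self, mul_zero, Finset.sum_const_zero, Real.exp_zero, Finset.sum_const,
        Finset.card_univ, nsmul_eq_mul, mul_one]
      rw [← hn, hw]; field_simp
    simp only [F, h4] at h1
    linarith
  by_contra! hr
  set B := Finset.univ.filter fun i => 0 < y i ∧ y i < 1 with hB
  set J := Finset.univ.filter fun j => s j y = Δ with hJ
  -- By the choice of `Δ`, each tight row contributes exactly 8 to a penalty of at most `m / 2`.
  have hJcard : (J.card : ℝ) ≤ m / 16 := by
    have h1 : ∑ j ∈ J, Real.exp (l * s j y) ≤ ∑ j, Real.exp (l * s j y) :=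
      Finset.sum_le_univ_sum_of_nonneg fun _ => (Real.exp_pos _).le
    have h2 : ∑ j ∈ J, Real.exp (l * s j y) = J.card * (32 * n / m) := by
      rw [Finset.sum_congr rfl fun j hj => by rw [(Finset.mem_filter.1 hj).2, hlΔ],
        Finset.sum_const, nsmul_eq_mul]
    have h3 : w * (J.card * (32 * n / m)) = 8 * J.card := by
      rw [hw]; field_simp; ring
    have h4 := mul_le_mul_of_nonneg_left (h2 ▸ h1) hw0.le
    linarith
  have hBA : B ⊆ A := by
    intro i hi
    by_contra hiA
    have h1 := (Finset.mem_filter.1 hi).2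
    rw [hyA i hiA] at h1
    exact hiA (by simpa [hA] using h1)
  have key := finrank_le_of_quadratic_bound a ha
    (fun j => 5 / 4 * l ^ 2 * (w * Real.exp (l * s j y))) (fun j => by positivity) B J ?_
  -- As 45/32 < 2, the trace bound gives `19/32 * |B| ≤ 2 + m / 8`, impossible for `|B| > m / 2` and
  -- `m ≥ 16`.
  · have h1 : ∑ j, 5 / 4 * l ^ 2 * (w * Real.exp (l * s j y)) ≤ 45 / 32 := by
      rw [← Finset.mul_sum, ← Finset.mul_sum]
      calc _ ≤ 5 / 4 * l ^ 2 * (m / 2) := by gcongr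
        _ = 45 / 32 := by rw [hl2]; field_simp; norm_num
    have h2 := mul_le_mul_of_nonneg_left h1 (Nat.cast_nonneg (α := ℝ) B.card)
    linarith
  · intro u huB husum huJ
    set c : ι → ℝ := fun j => ∑ i, a j i * u i with hc
    have hsadd : ∀ j t, s j (fun i => y i + t * u i) = s j y - t * c j := by
      intro j t
      simp only [s, hc, Finset.mul_sum, ← Finset.sum_sub_distrib]
      exact Finset.sum_congr rfl fun i _ => by ring
    have hD : ∀ᶠ t : ℝ in nhds 0, (fun i => y i + t * u i) ∈ D := by
      have h1 : ∀ᶠ t : ℝ in nhds 0, ∀ i, y i + t * u i ∈ Set.Icc (0 : ℝ) 1 := by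
        rw [Filter.eventually_all]
        intro i
        by_cases hi : i ∈ B
        · have hi' := (Finset.mem_filter.1 hi).2
          have hcont : Filter.Tendsto (fun t : ℝ => y i + t * u i) (nhds 0) (nhds (y i)) := by
            have : Continuous fun t : ℝ => y i + t * u i := by fun_prop
            simpa using this.tendsto 0
          exact hcont.eventually (Icc_mem_nhds hi'.1 hi'.2)
        · simpa [huB i hi] using hy01 i
      have h2 : ∀ᶠ t : ℝ in nhds 0, ∀ j, s j y - t * c j ≤ Δ := by
        rw [Filter.eventually_all]
        intro j
        by_cases hj : j ∈ J
        · simpa [hc, huJ j hj] using hyΔ j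
        · have hlt : s j y < Δ := lt_of_le_of_ne (hyΔ j) (by simpa [hJ] using hj)
          have hcont : Filter.Tendsto (fun t : ℝ => s j y - t * c j) (nhds 0) (nhds (s j y)) := by
            have : Continuous fun t : ℝ => s j y - t * c j := by fun_prop
            simpa using this.tendsto 0
          exact hcont.eventually_le_const hlt
      filter_upwards [h1, h2] with t ht1 ht2
      refine ⟨ht1, fun i hi => ?_, ?_, fun j => by rw [hsadd]; exact ht2 j⟩
      · simp [huB i fun h => hi (hBA h), hyA i hi]
      · rw [Finset.sum_add_distrib, ← Finset.mul_sum, husum, mul_zero, add_zero, hysum]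
    have hneg : ∀ᶠ t : ℝ in nhds 0, (fun i => y i + -t * u i) ∈ D := by
      have : Filter.Tendsto (fun t : ℝ => -t) (nhds 0) (nhds 0) := by
        simpa using (continuous_neg (G := ℝ)).tendsto 0
      exact this.eventually hD
    have hcosh : ∀ᶠ t : ℝ in nhds 0, ∀ j, Real.exp (t * (l * c j)) + Real.exp (-(t * (l * c j))) - 2
        ≤ 5 / 4 * (t * (l * c j)) ^ 2 := by
      rw [Filter.eventually_all]
      exact fun j => eventually_two_mul_cosh_sub_one_le _
    obtain ⟨t, ⟨⟨ht1, ht2⟩, ht3⟩, ht0⟩ := ((((hD.and hneg).and hcosh).filter_mono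
      (nhdsWithin_le_nhds (s := {0}ᶜ))).and self_mem_nhdsWithin).exists
    have ht0 : t ≠ 0 := ht0
    -- Adding the inequalities at `t` and `-t` cancels the first-order terms.
    have hF1 : F _ ≤ F y := hy ht1
    have hF2 : F _ ≤ F y := hy ht2
    simp only [F, hsadd] at hF1 hF2
    have hq : ∑ i ∈ A, (y i + t * u i - 1 / 2) ^ 2 + ∑ i ∈ A, (y i + -t * u i - 1 / 2) ^ 2
        = 2 * ∑ i ∈ A, (y i - 1 / 2) ^ 2 + t ^ 2 * (2 * ∑ i, u i ^ 2) := by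
      rw [← Finset.sum_subset (Finset.subset_univ A) fun i _ hi => by
        simp [huB i fun h => hi (hBA h)]]
      simp only [Finset.mul_sum, ← Finset.sum_add_distrib]
      exact Finset.sum_congr rfl fun i _ => by ring
    have he : w * ∑ j, Real.exp (l * (s j y - t * c j)) + w * ∑ j, Real.exp (l * (s j y - -t * c j))
        ≤ 2 * (w * ∑ j, Real.exp (l * s j y))
          + t ^ 2 * ∑ j, 5 / 4 * l ^ 2 * (w * Real.exp (l * s j y)) * c j ^ 2 := by
      simp only [Finset.mul_sum, ← Finset.sum_add_distrib]
      refine Finset.sum_le_sum fun j _ => ?_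
      have h1 := mul_le_mul_of_nonneg_left (ht3 j) (mul_pos hw0 (Real.exp_pos (l * s j y))).le
      have h2 : Real.exp (l * (s j y - t * c j))
          = Real.exp (l * s j y) * Real.exp (-(t * (l * c j))) := by
        rw [← Real.exp_add]; ring_nf
      have h3 : Real.exp (l * (s j y - -t * c j))
          = Real.exp (l * s j y) * Real.exp (t * (l * c j)) := by
        rw [← Real.exp_add]; ring_nf
      rw [h2, h3]
      linarith
    exact le_of_mul_le_mul_left (by linarith) (by positivity : 0 < t ^ 2)

/-! ### Iterated halving and full rounding. -/

theorem exists_iterated_rounding {V ι : Type*} [Fintype V] [DecidableEq V] [Fintype ι]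
    (a : ι → V → ℝ) (ha : ∀ j i, |a j i| ≤ 1) (hVn : Fintype.card V ≤ Fintype.card ι)
    (x : V → ℝ) (hx : ∀ i, x i ∈ Set.Icc (0 : ℝ) 1) (t : ℕ) :
    ∃ y : V → ℝ, (∀ i, y i ∈ Set.Icc (0 : ℝ) 1) ∧ ∑ i, y i = ∑ i, x i ∧
      ((Finset.univ.filter fun i => 0 < y i ∧ y i < 1).card : ℝ)
        ≤ max 16 ((Fintype.card ι : ℝ) * (1 / 2) ^ t) ∧
      ∀ j, ∑ i, a j i * (x i - y i)
        ≤ √(Fintype.card ι : ℝ) * (12 - (12 + 1.6 * t) * √(1 / 2) ^ t) := by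
  set n : ℝ := (Fintype.card ι : ℝ) with hn
  have hq2 : √(1 / 2 : ℝ) ^ 2 = 1 / 2 := Real.sq_sqrt (by norm_num)
  have hq1 : √(1 / 2 : ℝ) ≤ 0.7072 := by
    rw [Real.sqrt_le_left (by norm_num)]; norm_num
  induction t with
  | zero =>
    refine ⟨x, hx, rfl, le_max_of_le_right ?_, fun j => by simp⟩
    rw [pow_zero, mul_one]
    exact Nat.cast_le.2 ((Finset.card_le_univ _).trans hVn)
  | succ t ih =>
    obtain ⟨y, hy, hys, hyc, hya⟩ := ih
    -- Round `t` has `m = n / 2 ^ t` and costs `√n` times `2/3 * log 2 * (5 + t) * √(1/2) ^ t`. The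
    -- constants 12 and 1.6 make the closed form grow at least this much.
    have hinc : 0.4622 * (5 + t) * √(1 / 2 : ℝ) ^ t ≤
        (12 - (12 + 1.6 * (t + 1 : ℕ)) * √(1 / 2) ^ (t + 1))
          - (12 - (12 + 1.6 * t) * √(1 / 2) ^ t) := by
      have h0 : 0 ≤ √(1 / 2 : ℝ) ^ t := by positivity
      have h1 : 0.4622 * (5 + t) ≤ 12 + 1.6 * (t : ℝ) - (12 + 1.6 * (t + 1 : ℝ)) * √(1 / 2) := by
        have : (0 : ℝ) ≤ t := Nat.cast_nonneg t
        nlinarith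
      rw [pow_succ]
      push_cast
      nlinarith [mul_le_mul_of_nonneg_right h1 h0]
    have hinc0 : 0 ≤ 0.4622 * (5 + (t : ℝ)) * √(1 / 2 : ℝ) ^ t := by positivity
    have hsn : 0 ≤ √n := Real.sqrt_nonneg _
    by_cases hm : 16 ≤ n * (1 / 2) ^ t
    · rw [max_eq_right hm] at hyc
      have hn0 : 0 < n := by
        by_contra! h
        have : n * (1 / 2) ^ t ≤ 0 := mul_nonpos_of_nonpos_of_nonneg h (by positivity)
        linarith
      obtain ⟨z, hz, hzs, hzc, hza⟩ := exists_partial_rounding a ha y hy (n * (1 / 2) ^ t) hm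
        (mul_le_of_le_one_right hn0.le (pow_le_one₀ (by norm_num) (by norm_num))) hyc
      refine ⟨z, hz, hzs.trans hys, le_max_of_le_right (hzc.trans_eq (by ring)), fun j => ?_⟩
      have h1 : √(n * (1 / 2) ^ t) = √n * √(1 / 2) ^ t := by
        rw [Real.sqrt_mul hn0.le]
        congr 1
        rw [Real.sqrt_eq_iff_mul_self_eq (by positivity) (by positivity), ← mul_pow, ← sq, hq2]
      have h2 : Real.log (32 * n / (n * (1 / 2) ^ t)) = (5 + t) * Real.log 2 := by
        have : 32 * n / (n * (1 / 2) ^ t) = 2 ^ (5 + t) := by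
          rw [pow_add, one_div, inv_pow]; field_simp; norm_num
        rw [this, Real.log_pow]; push_cast; ring
      have h3 := hza j
      rw [← hn, h1, h2] at h3
      have h4 : 2 * (√n * √(1 / 2) ^ t) / 3 * ((5 + t) * Real.log 2)
          ≤ √n * (0.4622 * (5 + t) * √(1 / 2) ^ t) := by
        have h5 : 2 / 3 * Real.log 2 ≤ 0.4622 := by linarith [Real.log_two_lt_d9]
        have h6 : 0 ≤ √n * ((5 + t) * √(1 / 2) ^ t) := by positivity
        nlinarith [mul_le_mul_of_nonneg_left h5 h6]
      have h7 : ∑ i, a j i * (x i - z i)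
          = ∑ i, a j i * (x i - y i) + ∑ i, a j i * (y i - z i) := by
        rw [← Finset.sum_add_distrib]
        exact Finset.sum_congr rfl fun i _ => by ring
      have h8 := hya j
      have h9 := mul_le_mul_of_nonneg_left hinc hsn
      linarith
    · push Not at hm
      rw [max_eq_left hm.le] at hyc
      refine ⟨y, hy, hys, le_max_of_le_left hyc, fun j => (hya j).trans ?_⟩
      exact mul_le_mul_of_nonneg_left (by linarith) hsn

/-- A one-sided version of Spencer's "six standard deviations" bound, for rounding a fractional
point to the indicator of a set of prescribed size. -/
theorem exists_finset_card_eq_of_fractional {V ι : Type*} [Fintype V] [DecidableEq V] [Fintype ι]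
    (a : ι → V → ℝ) (ha0 : ∀ j i, 0 ≤ a j i) (ha1 : ∀ j i, a j i ≤ 1)
    (hVn : Fintype.card V ≤ Fintype.card ι)
    (x : V → ℝ) (hx : ∀ i, x i ∈ Set.Icc (0 : ℝ) 1) (k : ℕ) (hk : ∑ i, x i = k) :
    ∃ Z : Finset V, Z.card = k ∧ ∀ j,
      ∑ i, a j i * x i - (12 * √(Fintype.card ι : ℝ) + 16) ≤ ∑ i ∈ Z, a j i := by
  have ht : ∃ t : ℕ, (Fintype.card ι : ℝ) * (1 / 2) ^ t ≤ 16 := by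
    have h := (tendsto_pow_atTop_nhds_zero_of_lt_one (r := (1 / 2 : ℝ)) (by norm_num)
      (by norm_num)).const_mul (Fintype.card ι : ℝ)
    rw [mul_zero] at h
    exact (h.eventually_le_const (by norm_num : (0 : ℝ) < 16)).exists
  obtain ⟨t, ht⟩ := ht
  obtain ⟨y, hy, hys, hyc, hya⟩ := exists_iterated_rounding a
    (fun j i => abs_le.2 ⟨by linarith [ha0 j i], ha1 j i⟩) hVn x hx t
  rw [max_eq_left ht] at hyc
  obtain ⟨Z, hZ, hZa⟩ := exists_finset_card_eq_of_sum_eq a ha0 ha1 y hy k (hys.trans hk)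
  refine ⟨Z, hZ, fun j => ?_⟩
  have h1 := hZa j
  have h2 := hya j
  have h3 : √(Fintype.card ι : ℝ) * (12 - (12 + 1.6 * t) * √(1 / 2) ^ t)
      ≤ 12 * √(Fintype.card ι : ℝ) := by
    have h4 : 0 ≤ (12 + 1.6 * (t : ℝ)) * √(1 / 2) ^ t := by positivity
    rw [mul_comm]
    exact mul_le_mul_of_nonneg_right (by linarith) (Real.sqrt_nonneg _)
  simp only [mul_sub, Finset.sum_sub_distrib] at h2
  linarith

/-! ### Application to minimum degree. -/

theorem mainTheorem4 {V : Type*} [Fintype V] [DecidableEq V]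
    (G : SimpleGraph V) [DecidableRel G.Adj]
    (k : ℕ) (hk : 0 < k) (P : ℝ) (hP : 1 < P)
    (hcard : (Fintype.card V : ℝ) = P * (k : ℝ))
    (η : ℝ) (hη : 0 < η)
    (hdeg : (1 / 2 : ℝ) * (Fintype.card V : ℝ) + η * Real.sqrt (Fintype.card V : ℝ)
      ≤ (G.minDegree : ℝ)) :
    ∃ Z : Finset V, Z.card = k ∧
      (1 / 2 : ℝ) * (k : ℝ) + (η / Real.sqrt P - 19 * Real.sqrt P) * Real.sqrt (k : ℝ)
        ≤ ((G.induce (Z : Set V)).minDegree : ℝ) := by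
  have hP0 : 0 < P := by linarith
  have hk0 : (0 : ℝ) < k := by exact_mod_cast hk
  have hl0 : (0 : ℝ) < Fintype.card V := by rw [hcard]; positivity
  have hkl : (k : ℝ) ≤ Fintype.card V := by rw [hcard]; nlinarith
  have hne : Nonempty V := Fintype.card_pos_iff.1 (by exact_mod_cast hl0)
  have hs : √(Fintype.card V : ℝ) = √P * √k := by rw [hcard, Real.sqrt_mul hP0.le]
  have htarget : (1 / 2 : ℝ) * k + (η / √P - 19 * √P) * √k
      = (1 / 2 * Fintype.card V + η * √(Fintype.card V : ℝ)) / P - 19 * √(Fintype.card V : ℝ) := by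
    have h1 : 0 < √P := Real.sqrt_pos.2 hP0
    have h2 : P = √P * √P := (Real.mul_self_sqrt hP0.le).symm
    have h3 : η / √P * √k = η * √(Fintype.card V : ℝ) / P := by
      rw [hs]
      nth_rewrite 3 [h2]
      field_simp
    have h4 : (1 / 2 : ℝ) * k = 1 / 2 * Fintype.card V / P := by
      rw [hcard]; field_simp
    rw [sub_mul, h3, h4, hs]; ring
  rw [htarget]
  -- Here the target is nonpositive, since the minimum degree is at most `ℓ = P * k`; any `k`-set
  -- works.
  by_cases hsmall : (k : ℝ) ≤ 19 * √(Fintype.card V : ℝ)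
  · obtain ⟨Z, -, hZ⟩ := Finset.exists_subset_card_eq
      (show k ≤ (Finset.univ : Finset V).card by rw [Finset.card_univ]; exact_mod_cast hkl)
    refine ⟨Z, hZ, le_trans ?_ (Nat.cast_nonneg _)⟩
    have h1 : (G.minDegree : ℝ) ≤ Fintype.card V := by
      exact_mod_cast (G.minDegree_lt_card).le
    have h2 : (1 / 2 * Fintype.card V + η * √(Fintype.card V : ℝ)) / P ≤ k := by
      rw [div_le_iff₀ hP0]; linarith
    linarith
  · push Not at hsmall
    have hsq := Real.mul_self_sqrt hl0.le
    have hspos : 0 < √(Fintype.card V : ℝ) := Real.sqrt_pos.2 hl0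
    -- This absorbs the additive 16: `12 * √ℓ + 16 ≤ 19 * √ℓ`.
    have h19 : 19 < √(Fintype.card V : ℝ) := by nlinarith
    obtain ⟨Z, hZ, hZa⟩ := exists_finset_card_eq_of_fractional
      (fun v u => if G.Adj v u then (1 : ℝ) else 0)
      (fun j i => by split_ifs <;> norm_num) (fun j i => by split_ifs <;> norm_num)
      le_rfl (fun _ => 1 / P)
      (fun i => ⟨by positivity, by rw [div_le_one hP0]; exact hP.le⟩) k
      (by rw [Finset.sum_const, Finset.card_univ, nsmul_eq_mul, hcard]; field_simp)
    refine ⟨Z, hZ, ?_⟩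
    have : Nonempty (Z : Set V) := by
      obtain ⟨z, hz⟩ := Finset.card_pos.1 (hZ ▸ hk)
      exact ⟨⟨z, hz⟩⟩
    obtain ⟨v, hv⟩ := (G.induce (Z : Set V)).exists_minimal_degree_vertex
    rw [hv]
    have h1 := hZa v
    have h2 : ∑ i ∈ Z, (if G.Adj v i then (1 : ℝ) else 0)
        = ((G.induce (Z : Set V)).degree v : ℝ) := by
      rw [Finset.sum_boole, ← SimpleGraph.card_neighborFinset_eq_degree,
        ← Finset.card_map (Function.Embedding.subtype _)]
      congr 2
      ext u
      simp
      tauto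
    have h3 : ∑ i, (if G.Adj v i then (1 : ℝ) else 0) * (1 / P) = (G.degree v : ℝ) / P := by
      rw [← Finset.sum_mul, Finset.sum_boole, ← SimpleGraph.card_neighborFinset_eq_degree,
        SimpleGraph.neighborFinset_eq_filter, mul_one_div]
    have h4 : (1 / 2 * Fintype.card V + η * √(Fintype.card V : ℝ)) / P ≤ (G.degree v : ℝ) / P := by
      have : (G.minDegree : ℝ) ≤ G.degree v := by exact_mod_cast G.minDegree_le_degree v
      gcongr
      linarith
    rw [h2, h3] at h1
    linarith
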